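/- Let $n\ge 2$, let $\Omega\subset\mathbb{R}^n$ be a bounded open set, and let $1<p<\infty$. All functions are real valued. Let $L^\infty_+(\Omega)$ be the set of $\sigma\in L^\infty(\Omega)$ such that $\sigma>\varepsilon$ a.e. in $\Omega$ for some $\varepsilon>0$. Let $W^{1,p}_0(\Omega)$ be the closure of $C_c^\infty(\Omega)$ in $W^{1,p}(\Omega)$, let $X=W^{1,p}(\Omega)/W^{1,p}_0(\Omega)$ be the abstract trace space, $X'$ its dual with duality $(\cdot,\cdot)$, and write $u|_{\partial\Omega}\in X$ for the class of $u\in W^{1,p}(\Omega)$. For $\sigma\in L^\infty_+(\Omega)$ and $F\in X$ the Dirichlet problem $$\operatorname{div}(\sigma|\nabla u|^{p-2}\nabla u)=0\ \text{ in }\Omega\ \text{(in the sense of distributions)},\qquad u|_{\partial\Omega}=F,$$ has a unique solution $u\in W^{1,p}(\Omega)$, and the nonlinear Dirichlet-to-Neumann map $\Lambda_\sigma:X\to X'$ is well defined by $$(\Lambda_\sigma F,\,v|_{\partial\Omega})=\int_\Omega \sigma|\nabla u|^{p-2}\nabla u\cdot\nabla v\,dx\qquad\text{for all } v\in W^{1,p}(\Omega).$$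 Moreover, let $\sigma_0,\sigma_1\in L^\infty_+(\Omega)$ and $f\in W^{1,p}(\Omega)$, and let $u_0\in W^{1,p}(\Omega)$ be the solution of $\operatorname{div}(\sigma_0|\nabla u_0|^{p-2}\nabla u_0)=0$ in $\Omega$ with $u_0|_{\partial\Omega}=f|_{\partial\Omega}$. Then, writing $f$ also for $f|_{\partial\Omega}$, $$(p-1)\int_\Omega \frac{\sigma_0}{\sigma_1^{1/(p-1)}}\Big(\sigma_1^{\frac1{p-1}}-\sigma_0^{\frac1{p-1}}\Big)|\nabla u_0|^p\,dx\ \le\ \big((\Lambda_{\sigma_1}-\Lambda_{\sigma_0})f,f\big)\ \le\ \int_\Omega(\sigma_1-\sigma_0)|\nabla u_0|^p\,dx .$$ -/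

import Mathlib

open MeasureTheory

noncomputable section

namespace PCalderon

/-- Euclidean space `ℝⁿ`. -/
abbrev E (n : ℕ) : Type := EuclideanSpace ℝ (Fin n)

instance factOneLeOfReal (p : ℝ) [hp : Fact (1 < p)] : Fact (1 ≤ ENNReal.ofReal p) :=
  ⟨by simpa using ENNReal.ofReal_le_ofReal hp.out.le⟩

/-- The conductivity class `L^∞₊(Ω)`: essentially bounded measurable functions on `Ω` that are
essentially bounded below by a positive constant. -/
def LinftyPos {n : ℕ} (Ω : Set (E n)) : Set (E n → ℝ) :=
  {σ | MemLp σ ⊤ (volume.restrict Ω) ∧ ∃ ε : ℝ, 0 < ε ∧ ∀ᵐ x ∂(volume.restrict Ω), ε < σ x}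

/-- Test functions `C_c^∞(Ω)`, extended by zero to `ℝⁿ`. -/
structure IsTestFunction {n : ℕ} (Ω : Set (E n)) (φ : E n → ℝ) : Prop where
  smooth : ContDiff ℝ (⊤ : ℕ∞) φ
  hasCompactSupport : HasCompactSupport φ
  tsupport_subset : tsupport φ ⊆ Ω

/-- `G` is the weak gradient of `u` in `Ω`: `∫_Ω u ∇φ = - ∫_Ω φ G` for all test functions `φ`. -/
def HasWeakGradient {n : ℕ} (Ω : Set (E n)) (u : E n → ℝ) (G : E n → E n) : Prop :=
  ∀ φ : E n → ℝ, IsTestFunction Ω φ →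
    ∫ x in Ω, u x • gradient φ x = - ∫ x in Ω, φ x • G x

/-- The space `L^p(Ω) × L^p(Ω; ℝⁿ)`. -/
abbrev LpPair {n : ℕ} (Ω : Set (E n)) (p : ℝ) : Type :=
  Lp ℝ (ENNReal.ofReal p) (volume.restrict Ω) × Lp (E n) (ENNReal.ofReal p) (volume.restrict Ω)

section aux

variable {n : ℕ} {Ω : Set (E n)}

theorem IsTestFunction.zero : IsTestFunction Ω (0 : E n → ℝ) :=
  ⟨contDiff_const, HasCompactSupport.zero, by simp [tsupport]⟩

theorem IsTestFunction.add {φ ψ : E n → ℝ} (hφ : IsTestFunction Ω φ) (hψ : IsTestFunction Ω ψ) :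
    IsTestFunction Ω (φ + ψ) :=
  ⟨hφ.smooth.add hψ.smooth, hφ.hasCompactSupport.add hψ.hasCompactSupport,
    (tsupport_add φ ψ).trans (Set.union_subset hφ.tsupport_subset hψ.tsupport_subset)⟩

theorem IsTestFunction.const_smul {φ : E n → ℝ} (c : ℝ) (hφ : IsTestFunction Ω φ) :
    IsTestFunction Ω (c • φ) :=
  ⟨contDiff_const.smul hφ.smooth, hφ.hasCompactSupport.smul_left (f := fun _ => c),
    (tsupport_smul_subset_right (fun _ => c) φ).trans hφ.tsupport_subset⟩

theorem IsTestFunction.differentiable {φ : E n → ℝ} (hφ : IsTestFunction Ω φ) :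
    Differentiable ℝ φ := hφ.smooth.differentiable (by simp)

theorem IsTestFunction.continuous_gradient {φ : E n → ℝ} (hφ : IsTestFunction Ω φ) :
    Continuous (gradient φ) :=
  (InnerProductSpace.toDual ℝ (E n)).symm.continuous.comp
    (hφ.smooth.continuous_fderiv (by simp))

theorem IsTestFunction.hasCompactSupport_gradient {φ : E n → ℝ} (hφ : IsTestFunction Ω φ) :
    HasCompactSupport (gradient φ) :=
  (hφ.hasCompactSupport.fderiv ℝ).comp_left (g := (InnerProductSpace.toDual ℝ (E n)).symm)
    (map_zero _)

theorem gradient_add' {φ ψ : E n → ℝ} (hφ : Differentiable ℝ φ) (hψ : Differentiable ℝ ψ) :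
    gradient (φ + ψ) = gradient φ + gradient ψ := by
  ext1 x
  simp [gradient, fderiv_add (hφ x) (hψ x)]

theorem gradient_const_smul' {φ : E n → ℝ} (c : ℝ) (hφ : Differentiable ℝ φ) :
    gradient (c • φ) = c • gradient φ := by
  ext1 x
  simp [gradient, fderiv_const_smul (hφ x) c]

theorem integrable_smul_gradient {p : ℝ} [Fact (1 < p)]
    (u : Lp ℝ (ENNReal.ofReal p) (volume.restrict Ω)) {φ : E n → ℝ} (hφ : IsTestFunction Ω φ) :
    Integrable (fun x => u x • gradient φ x) (volume.restrict Ω) :=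
  ((Lp.memLp u).locallyIntegrable Fact.out).integrable_smul_right_of_hasCompactSupport
    hφ.continuous_gradient hφ.hasCompactSupport_gradient

theorem integrable_test_smul {p : ℝ} [Fact (1 < p)]
    (G : Lp (E n) (ENNReal.ofReal p) (volume.restrict Ω)) {φ : E n → ℝ}
    (hφ : IsTestFunction Ω φ) :
    Integrable (fun x => φ x • G x) (volume.restrict Ω) :=
  ((Lp.memLp G).locallyIntegrable Fact.out).integrable_smul_left_of_hasCompactSupport
    hφ.smooth.continuous hφ.hasCompactSupport

end aux

/-- The Sobolev space `W^{1,p}(Ω)`: pairs `(u, ∇u)` in `L^p(Ω) × L^p(Ω; ℝⁿ)` whose second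
component is the weak gradient of the first, with the (equivalent) norm
`max (‖u‖_p) (‖∇u‖_p)`. -/
def W1p {n : ℕ} (Ω : Set (E n)) (p : ℝ) [Fact (1 < p)] : Submodule ℝ (LpPair Ω p) where
  carrier := {w | HasWeakGradient Ω w.1 w.2}
  zero_mem' := by
    intro φ _
    have h1 : ∀ᵐ x ∂(volume.restrict Ω),
        ((0 : LpPair Ω p).1 x) • gradient φ x = 0 := by
      filter_upwards [Lp.coeFn_zero ℝ (ENNReal.ofReal p) (volume.restrict Ω)] with x hx
      rw [Prod.fst_zero, hx, Pi.zero_apply, zero_smul]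
    have h2 : ∀ᵐ x ∂(volume.restrict Ω), φ x • ((0 : LpPair Ω p).2 x) = 0 := by
      filter_upwards [Lp.coeFn_zero (E n) (ENNReal.ofReal p) (volume.restrict Ω)] with x hx
      rw [Prod.snd_zero, hx, Pi.zero_apply, smul_zero]
    rw [integral_congr_ae h1, integral_congr_ae h2]
    simp
  add_mem' := by
    intro a b ha hb φ hφ
    have h1 : ∀ᵐ x ∂(volume.restrict Ω), ((a + b).1 x) • gradient φ x
        = a.1 x • gradient φ x + b.1 x • gradient φ x := by
      filter_upwards [Lp.coeFn_add a.1 b.1] with x hx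
      rw [Prod.fst_add, hx, Pi.add_apply, add_smul]
    have h2 : ∀ᵐ x ∂(volume.restrict Ω), φ x • ((a + b).2 x)
        = φ x • a.2 x + φ x • b.2 x := by
      filter_upwards [Lp.coeFn_add a.2 b.2] with x hx
      rw [Prod.snd_add, hx, Pi.add_apply, smul_add]
    rw [integral_congr_ae h1, integral_congr_ae h2,
      integral_add (integrable_smul_gradient a.1 hφ) (integrable_smul_gradient b.1 hφ),
      integral_add (integrable_test_smul a.2 hφ) (integrable_test_smul b.2 hφ),
      ha φ hφ, hb φ hφ, neg_add]
  smul_mem' := by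
    intro c a ha φ hφ
    have h1 : ∀ᵐ x ∂(volume.restrict Ω), ((c • a).1 x) • gradient φ x
        = c • (a.1 x • gradient φ x) := by
      filter_upwards [Lp.coeFn_smul c a.1] with x hx
      rw [Prod.smul_fst, hx, Pi.smul_apply, smul_assoc]
    have h2 : ∀ᵐ x ∂(volume.restrict Ω), φ x • ((c • a).2 x) = c • (φ x • a.2 x) := by
      filter_upwards [Lp.coeFn_smul c a.2] with x hx
      rw [Prod.smul_snd, hx, Pi.smul_apply, smul_comm]
    rw [integral_congr_ae h1, integral_congr_ae h2, integral_smul, integral_smul, ha φ hφ,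
      smul_neg]

section space

variable {n : ℕ} {Ω : Set (E n)} {p : ℝ} [Fact (1 < p)]

/-- The weak gradient `∇u` of `u ∈ W^{1,p}(Ω)`. -/
def weakGrad (u : W1p Ω p) : E n → E n := (u : LpPair Ω p).2

end space

/-- The elements of `W^{1,p}(Ω)` that are given by test functions. -/
def testSubmodule {n : ℕ} (Ω : Set (E n)) (p : ℝ) [Fact (1 < p)] : Submodule ℝ (W1p Ω p) where
  carrier := {w | ∃ φ : E n → ℝ, IsTestFunction Ω φ ∧
    (w : LpPair Ω p).1 =ᵐ[volume.restrict Ω] φ ∧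
    (w : LpPair Ω p).2 =ᵐ[volume.restrict Ω] gradient φ}
  zero_mem' := by
    refine ⟨0, IsTestFunction.zero, Lp.coeFn_zero _ _ _, ?_⟩
    have h : gradient (0 : E n → ℝ) = 0 := by
      ext1 x
      simp [gradient]
    rw [h]
    exact Lp.coeFn_zero _ _ _
  add_mem' := by
    rintro a b ⟨φ, hφ, h1, h2⟩ ⟨ψ, hψ, h3, h4⟩
    refine ⟨φ + ψ, hφ.add hψ, (Lp.coeFn_add _ _).trans (h1.add h3), ?_⟩
    rw [gradient_add' hφ.differentiable hψ.differentiable]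
    exact (Lp.coeFn_add _ _).trans (h2.add h4)
  smul_mem' := by
    rintro c a ⟨φ, hφ, h1, h2⟩
    refine ⟨c • φ, hφ.const_smul c, (Lp.coeFn_smul _ _).trans (h1.const_smul c), ?_⟩
    rw [gradient_const_smul' c hφ.differentiable]
    exact (Lp.coeFn_smul _ _).trans (h2.const_smul c)

/-- `W_0^{1,p}(Ω)`: the closure of the test functions in `W^{1,p}(Ω)`. -/
def W1p0 {n : ℕ} (Ω : Set (E n)) (p : ℝ) [Fact (1 < p)] : Submodule ℝ (W1p Ω p) :=
  (testSubmodule Ω p).topologicalClosure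

/-- The abstract trace space `X = W^{1,p}(Ω) / W_0^{1,p}(Ω)`. -/
abbrev TraceSpace {n : ℕ} (Ω : Set (E n)) (p : ℝ) [Fact (1 < p)] : Type :=
  W1p Ω p ⧸ W1p0 Ω p

section problem

variable {n : ℕ} {Ω : Set (E n)} {p : ℝ} [Fact (1 < p)]

/-- The boundary value `u|_{∂Ω} ∈ X` of `u ∈ W^{1,p}(Ω)`. -/
def trace (u : W1p Ω p) : TraceSpace Ω p := (W1p0 Ω p).mkQ u

/-- The `p`-Laplace flux `σ |∇u|^{p-2} ∇u` of `u`. -/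
def flux (σ : E n → ℝ) (u : W1p Ω p) (x : E n) : E n :=
  (σ x * ‖weakGrad u x‖ ^ (p - 2)) • weakGrad u x

/-- `div(σ |∇u|^{p-2} ∇u) = 0` in `Ω`, in the sense of distributions. -/
def IsWeakSolution (σ : E n → ℝ) (u : W1p Ω p) : Prop :=
  ∀ φ : E n → ℝ, IsTestFunction Ω φ → ∫ x in Ω, inner ℝ (flux σ u x) (gradient φ x) = 0

/-- `u` solves the Dirichlet problem `div(σ |∇u|^{p-2} ∇u) = 0` in `Ω`, `u|_{∂Ω} = F`. -/
def SolvesDirichlet (σ : E n → ℝ) (F : TraceSpace Ω p) (u : W1p Ω p) : Prop :=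
  IsWeakSolution σ u ∧ trace u = F

/-- `ℓ ∈ X'` is the weak normal flux of the solution with boundary value `F`:
`(ℓ, v|_{∂Ω}) = ∫_Ω σ |∇u|^{p-2} ∇u · ∇v` for every `v ∈ W^{1,p}(Ω)`. -/
def IsDNValue (σ : E n → ℝ) (F : TraceSpace Ω p) (ℓ : StrongDual ℝ (TraceSpace Ω p)) : Prop :=
  ∃ u : W1p Ω p, SolvesDirichlet σ F u ∧
    ∀ v : W1p Ω p, ℓ (trace v) = ∫ x in Ω, inner ℝ (flux σ u x) (weakGrad v x)

open Classical in
/-- The nonlinear Dirichlet-to-Neumann map `Λ_σ : X → X'`. -/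
def dnMap (σ : E n → ℝ) (F : TraceSpace Ω p) : StrongDual ℝ (TraceSpace Ω p) :=
  if h : ∃ ℓ, IsDNValue σ F ℓ then h.choose else 0

end problem

end PCalderon

end

noncomputable section

namespace PCalderon

/-! ### Pointwise inequalities for `|b|^p` and `|b|^(p-2) b`. -/

section pointwise

open Filter Topology

variable {V : Type*} [NormedAddCommGroup V] [InnerProductSpace ℝ V]

/-! Write E_σ(u) = ∫ σ|∇u|^p. It is convex with subgradient p·σ|∇u|^(p-2)∇u (`energy_subgradient`),
so solving the Dirichlet problem is the same as minimizing E_σ over f + W_0^{1,p}. Testing the weak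
formula with f gives (Λ_σ f, f) = E_σ(u) (`dnMap_trace_self`), and the claim becomes a comparison of
two minimal energies.

Upper bound: u₀ competes in the minimization for σ₁, so E_{σ₁}(u₁) ≤ E_{σ₁}(u₀). Lower bound: since
u₁ - u₀ lies in W_0^{1,p}, E_{σ₀}(u₀) = ∫ σ₀|∇u₀|^(p-2)∇u₀·∇u₁. Young's inequality with weights σ₀,
σ₁ (`weighted_young`) bounds p times this integrand by σ₁|∇u₁|^p plus
(p-1)σ₀(σ₀/σ₁)^(1/(p-1))|∇u₀|^p; integrating (`mul_fluxPairing_le`) and rearranging gives the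
estimate.

Existence uses no weak compactness. A quantitative form of strict convexity
(`exists_norm_sub_rpow_le`) and Poincaré's inequality make near-minimizers close in norm, so
minimizing sequences are Cauchy and minimizers are unique. -/

theorem norm_rpow_smul_self {p : ℝ} (hp : 1 < p) (b : V) :
    ‖(‖b‖ ^ (p - 2)) • b‖ = ‖b‖ ^ (p - 1) := by
  rcases eq_or_ne b 0 with rfl | hb
  · rw [smul_zero, norm_zero, Real.zero_rpow (by linarith)]
  · have h : 0 < ‖b‖ := norm_pos_iff.2 hb
    rw [norm_smul, Real.norm_of_nonneg (by positivity), ← Real.rpow_add_one h.ne']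
    ring_nf

theorem norm_rpow_mul_inner_self {p : ℝ} (hp : 1 < p) (b : V) :
    ‖b‖ ^ (p - 2) * inner ℝ b b = ‖b‖ ^ p := by
  rcases eq_or_ne b 0 with rfl | hb
  · rw [inner_zero_left, mul_zero, norm_zero, Real.zero_rpow (by linarith)]
  · have h : 0 < ‖b‖ := norm_pos_iff.2 hb
    rw [real_inner_self_eq_norm_sq, ← Real.rpow_two, ← Real.rpow_add h]
    ring_nf

/-- Only the origin is delicate, as p - 2 may be negative; there the norm of the product is `‖b‖ ^
(p - 1)`, which tends to 0. -/
theorem continuous_norm_rpow_smul {p : ℝ} (hp : 1 < p) :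
    Continuous fun b : V => (‖b‖ ^ (p - 2)) • b := by
  rw [continuous_iff_continuousAt]
  intro b
  rcases eq_or_ne b 0 with rfl | hb
  · rw [ContinuousAt, smul_zero, tendsto_zero_iff_norm_tendsto_zero]
    simp_rw [norm_rpow_smul_self hp]
    have h : Continuous fun b : V => ‖b‖ ^ (p - 1) :=
      continuous_norm.rpow_const fun _ => Or.inr (by linarith)
    have := h.tendsto 0
    rwa [norm_zero, Real.zero_rpow (by linarith)] at this
  · exact (continuous_norm.continuousAt.rpow_const (Or.inl (norm_ne_zero_iff.2 hb))).smul
      continuousAt_id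

/-- Young's inequality for the pairing of a `p`-Laplace flux with a vector. -/
theorem weighted_young {p : ℝ} (hp : 1 < p) {s t : ℝ} (hs : 0 < s) (ht : 0 < t) (a b : V) :
    p * (s * ‖b‖ ^ (p - 2) * inner ℝ b a)
      ≤ t * ‖a‖ ^ p + (p - 1) * (s * (s ^ (1 / (p - 1)) / t ^ (1 / (p - 1))) * ‖b‖ ^ p) := by
  have hp0 : 0 < p := by linarith
  have hp1 : 0 < p - 1 := by linarith
  have hpq : p.HolderConjugate (p / (p - 1)) := Real.HolderConjugate.conjExponent hp
  have h1 : ‖b‖ ^ (p - 2) * inner ℝ b a ≤ ‖b‖ ^ (p - 1) * ‖a‖ := by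
    rw [← real_inner_smul_left, ← norm_rpow_smul_self hp]
    exact real_inner_le_norm _ _
  -- The powers of t cancel in the product of the two factors and are placed so that the p-th power
  -- of the first is exactly t‖a‖^p.
  have h2 := Real.young_inequality_of_nonneg (a := t ^ (1 / p) * ‖a‖)
    (b := s / t ^ (1 / p) * ‖b‖ ^ (p - 1)) (by positivity) (by positivity) hpq
  have h3 : (t ^ (1 / p) * ‖a‖) ^ p = t * ‖a‖ ^ p := by
    rw [Real.mul_rpow (by positivity) (by positivity), ← Real.rpow_mul ht.le,
      one_div_mul_cancel hp0.ne', Real.rpow_one]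
  have h4 : (s / t ^ (1 / p) * ‖b‖ ^ (p - 1)) ^ (p / (p - 1))
      = s * (s ^ (1 / (p - 1)) / t ^ (1 / (p - 1))) * ‖b‖ ^ p := by
    rw [Real.mul_rpow (by positivity) (by positivity), Real.div_rpow hs.le (by positivity),
      ← Real.rpow_mul ht.le, ← Real.rpow_mul (norm_nonneg b)]
    have e1 : 1 / p * (p / (p - 1)) = 1 / (p - 1) := by field_simp
    have e2 : (p - 1) * (p / (p - 1)) = p := by field_simp
    have e3 : p / (p - 1) = 1 + 1 / (p - 1) := by field_simp; ring
    rw [e1, e2, e3, Real.rpow_add hs, Real.rpow_one]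
    ring
  have h5 : t ^ (1 / p) * ‖a‖ * (s / t ^ (1 / p) * ‖b‖ ^ (p - 1)) = s * (‖b‖ ^ (p - 1) * ‖a‖) := by
    have : t ^ (1 / p) ≠ 0 := by positivity
    field_simp
  rw [h3, h4, h5] at h2
  calc p * (s * ‖b‖ ^ (p - 2) * inner ℝ b a)
      = p * (s * (‖b‖ ^ (p - 2) * inner ℝ b a)) := by ring
    _ ≤ p * (s * (‖b‖ ^ (p - 1) * ‖a‖)) := by gcongr
    _ ≤ p * _ := mul_le_mul_of_nonneg_left h2 hp0.le
    _ = _ := by field_simp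

/-- The subgradient inequality for `‖·‖ ^ p`. -/
theorem rpow_norm_subgradient {p : ℝ} (hp : 1 < p) (a b : V) :
    ‖b‖ ^ p + p * (‖b‖ ^ (p - 2) * inner ℝ b (a - b)) ≤ ‖a‖ ^ p := by
  have h := weighted_young hp one_pos one_pos a b
  rw [inner_sub_right, mul_sub, norm_rpow_mul_inner_self hp]
  simp only [one_mul, Real.one_rpow, div_one] at h
  linarith

theorem norm_midpoint_rpow_lt {p : ℝ} (hp : 1 < p) {a b : V} (hab : a ≠ b) :
    ‖(1 / 2 : ℝ) • (a + b)‖ ^ p < (‖a‖ ^ p + ‖b‖ ^ p) / 2 := by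
  have hp0 : 0 < p := by linarith
  have hm : ‖(1 / 2 : ℝ) • (a + b)‖ ≤ (‖a‖ + ‖b‖) / 2 := by
    rw [norm_smul, Real.norm_of_nonneg (by norm_num)]
    linarith [norm_add_le a b]
  -- For equal norms the triangle inequality is strict, since distinct vectors of equal norm are not
  -- on one ray; otherwise scalar strict convexity of r ↦ r^p gives the strictness.
  by_cases h : ‖a‖ = ‖b‖
  · have : ‖(1 / 2 : ℝ) • (a + b)‖ < ‖b‖ := by
      rw [norm_smul, Real.norm_of_nonneg (by norm_num)]
      have : ‖a + b‖ < ‖a‖ + ‖b‖ := norm_add_lt_of_not_sameRay fun h' =>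
        hab ((sameRay_iff_of_norm_eq h).1 h')
      linarith
    rw [h]
    linarith [Real.rpow_lt_rpow (norm_nonneg _) this hp0]
  · have := (strictConvexOn_rpow hp).2 (norm_nonneg a) (norm_nonneg b) h
      one_half_pos one_half_pos (add_halves 1)
    simp only [smul_eq_mul] at this
    calc _ ≤ ((‖a‖ + ‖b‖) / 2) ^ p := Real.rpow_le_rpow (norm_nonneg _) hm hp0.le
      _ = (1 / 2 * ‖a‖ + 1 / 2 * ‖b‖) ^ p := by ring_nf
      _ < _ := this
      _ = _ := by ring

/-- A quantitative form of the strict convexity of `‖·‖ ^ p`. -/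
theorem exists_norm_sub_rpow_le [FiniteDimensional ℝ V] {p : ℝ} (hp : 1 < p) {η : ℝ}
    (hη : 0 < η) :
    ∃ c : ℝ, 0 ≤ c ∧ ∀ a b : V, ‖a - b‖ ^ p ≤ η * (‖a‖ ^ p + ‖b‖ ^ p)
      + c * ((‖a‖ ^ p + ‖b‖ ^ p) / 2 - ‖(1 / 2 : ℝ) • (a + b)‖ ^ p) := by
  have hp0 : 0 < p := by linarith
  have hcont {f : V × V → V} (hf : Continuous f) : Continuous fun z => ‖f z‖ ^ p :=
    hf.norm.rpow_const fun _ => Or.inr hp0.le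
  have hB : Continuous fun z : V × V => ‖z.1‖ ^ p + ‖z.2‖ ^ p :=
    (hcont continuous_fst).add (hcont continuous_snd)
  have hA : Continuous fun z : V × V => ‖z.1 - z.2‖ ^ p :=
    hcont (continuous_fst.sub continuous_snd)
  have hD : Continuous fun z : V × V =>
      (‖z.1‖ ^ p + ‖z.2‖ ^ p) / 2 - ‖(1 / 2 : ℝ) • (z.1 + z.2)‖ ^ p :=
    (hB.div_const 2).sub (hcont ((continuous_fst.add continuous_snd).const_smul _))
  have hD0 (a b : V) : 0 ≤ (‖a‖ ^ p + ‖b‖ ^ p) / 2 - ‖(1 / 2 : ℝ) • (a + b)‖ ^ p := by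
    rcases eq_or_ne a b with rfl | hab
    · rw [← two_smul ℝ a, smul_smul]; norm_num
    · linarith [norm_midpoint_rpow_lt hp hab]
  have : ProperSpace (V × V) := FiniteDimensional.proper_real _
  -- K is the part of the unit sphere where the η-term alone may not suffice. Pairs in K have a ≠ b,
  -- so by compactness the convexity gap has a positive minimum d on K.
  let K : Set (V × V) := Metric.sphere 0 1 ∩
    {z | η * (‖z.1‖ ^ p + ‖z.2‖ ^ p) ≤ ‖z.1 - z.2‖ ^ p}
  have hK : IsCompact K := (isCompact_sphere _ _).inter_right (isClosed_le (hB.const_mul η) hA)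
  have hsphere : ∃ c : ℝ, 0 ≤ c ∧ ∀ z ∈ Metric.sphere (0 : V × V) 1,
      ‖z.1 - z.2‖ ^ p ≤ η * (‖z.1‖ ^ p + ‖z.2‖ ^ p)
      + c * ((‖z.1‖ ^ p + ‖z.2‖ ^ p) / 2 - ‖(1 / 2 : ℝ) • (z.1 + z.2)‖ ^ p) := by
    rcases K.eq_empty_or_nonempty with hKe | hKn
    · refine ⟨0, le_rfl, fun z hz => ?_⟩
      by_contra! hlt
      have : z ∈ K := ⟨hz, by simp only [Set.mem_ofPred_eq]; linarith⟩
      simp [hKe] at this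
    · obtain ⟨w, hwK, hw⟩ := hK.exists_isMinOn hKn hD.continuousOn
      have hwpos : 0 < (‖w.1‖ ^ p + ‖w.2‖ ^ p) / 2 - ‖(1 / 2 : ℝ) • (w.1 + w.2)‖ ^ p := by
        have hne : w.1 ≠ w.2 := by
          intro heq
          have h2 := hwK.2
          have h1 := hwK.1
          simp only [Set.mem_ofPred_eq, heq, sub_self, norm_zero, Real.zero_rpow hp0.ne'] at h2
          have h3 : ‖w.2‖ ^ p ≤ 0 := by nlinarith [Real.rpow_nonneg (norm_nonneg w.2) p]
          have h4 : w.2 = 0 := by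
            by_contra h
            exact absurd (Real.rpow_pos_of_pos (norm_pos_iff.2 h) p) (not_lt.2 h3)
          have : w = 0 := Prod.ext (heq.trans h4) h4
          simp [this] at h1
        linarith [norm_midpoint_rpow_lt hp hne]
      set d := (‖w.1‖ ^ p + ‖w.2‖ ^ p) / 2 - ‖(1 / 2 : ℝ) • (w.1 + w.2)‖ ^ p
      -- On the unit sphere of the sup norm ‖a - b‖ ≤ 2, so this constant times a gap of at least d
      -- dominates the left side.
      refine ⟨2 ^ p / d, by positivity, fun z hz => ?_⟩
      by_cases hzK : z ∈ K
      · have h1 : d ≤ _ := hw hzK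
        have hz1 : ‖z‖ = 1 := by simpa using hz
        have h2 : ‖z.1 - z.2‖ ^ p ≤ 2 ^ p := by
          refine Real.rpow_le_rpow (norm_nonneg _) ?_ hp0.le
          linarith [norm_sub_le z.1 z.2, norm_fst_le z, norm_snd_le z]
        have h3 : 2 ^ p / d * d ≤ 2 ^ p / d *
            ((‖z.1‖ ^ p + ‖z.2‖ ^ p) / 2 - ‖(1 / 2 : ℝ) • (z.1 + z.2)‖ ^ p) := by gcongr
        rw [div_mul_cancel₀ _ hwpos.ne'] at h3
        have : 0 ≤ η * (‖z.1‖ ^ p + ‖z.2‖ ^ p) := by positivity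
        linarith
      · have h1 : ‖z.1 - z.2‖ ^ p < η * (‖z.1‖ ^ p + ‖z.2‖ ^ p) := by
          by_contra! h
          exact hzK ⟨hz, h⟩
        have := mul_nonneg (show 0 ≤ 2 ^ p / d by positivity) (hD0 z.1 z.2)
        linarith
  obtain ⟨c, hc, h⟩ := hsphere
  refine ⟨c, hc, fun a b => ?_⟩
  rcases eq_or_ne ((a, b) : V × V) 0 with hz | hz
  · obtain ⟨rfl, rfl⟩ : a = 0 ∧ b = 0 := by simpa using hz
    simp [Real.zero_rpow hp0.ne']
  · have hr : 0 < ‖((a, b) : V × V)‖ := norm_pos_iff.2 hz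
    set r := ‖((a, b) : V × V)‖
    -- Every term is homogeneous of degree p, so the unit sphere suffices.
    have key := h (r⁻¹ • (a, b)) (by
      rw [mem_sphere_zero_iff_norm, norm_smul, norm_inv, Real.norm_of_nonneg hr.le]
      exact inv_mul_cancel₀ hr.ne')
    have hn (x : V) : ‖r⁻¹ • x‖ ^ p = (r⁻¹) ^ p * ‖x‖ ^ p := by
      rw [norm_smul, Real.norm_of_nonneg (by positivity),
        Real.mul_rpow (by positivity) (norm_nonneg _)]
    simp only [Prod.smul_fst, Prod.smul_snd, ← smul_sub, ← smul_add, smul_comm _ r⁻¹, hn] at key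
    have hrp : 0 < (r⁻¹) ^ p := by positivity
    refine le_of_mul_le_mul_left ?_ hrp
    linarith

end pointwise

/-! ### Completeness of W^{1,p}, test functions and Poincaré's inequality. -/

section sobolev

open Filter Topology
open scoped ENNReal NNReal

variable {n : ℕ} {Ω : Set (E n)} {p : ℝ} [hp : Fact (1 < p)]

theorem holderConjugate_ofReal (p : ℝ) [hp : Fact (1 < p)] :
    (ENNReal.ofReal p).HolderConjugate (ENNReal.ofReal (p / (p - 1))) :=
  (Real.HolderConjugate.conjExponent hp.out).ennrealOfReal

/-- Integration against a fixed function in the conjugate space is continuous on `L^p`. -/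
theorem exists_integral_lp_pairing {α F G H : Type*} [MeasurableSpace α] {μ : Measure α}
    [NormedAddCommGroup F] [NormedSpace ℝ F] [NormedAddCommGroup G] [NormedSpace ℝ G]
    [NormedAddCommGroup H] [NormedSpace ℝ H] [CompleteSpace H]
    (B : F →L[ℝ] G →L[ℝ] H) {g : α → G} (hg : MemLp g (ENNReal.ofReal (p / (p - 1))) μ) :
    ∃ L : Lp F (ENNReal.ofReal p) μ →L[ℝ] H, ∀ f, L f = ∫ x, B (f x) (g x) ∂μ := by
  have := holderConjugate_ofReal p
  have hq : Fact (1 ≤ ENNReal.ofReal (p / (p - 1))) :=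
    ⟨ENNReal.one_le_ofReal.2 (Real.HolderConjugate.conjExponent hp.out).symm.lt.le⟩
  refine ⟨(B.lpPairing μ (ENNReal.ofReal p) (ENNReal.ofReal (p / (p - 1)))).flip (hg.toLp g),
    fun f => ?_⟩
  rw [ContinuousLinearMap.flip_apply, ContinuousLinearMap.lpPairing_eq_integral]
  refine integral_congr_ae ?_
  filter_upwards [hg.coeFn_toLp] with x hx
  rw [hx]

theorem continuous_integral_lp_pairing {α F G H : Type*} [MeasurableSpace α] {μ : Measure α}
    [NormedAddCommGroup F] [NormedSpace ℝ F] [NormedAddCommGroup G] [NormedSpace ℝ G]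
    [NormedAddCommGroup H] [NormedSpace ℝ H] [CompleteSpace H]
    (B : F →L[ℝ] G →L[ℝ] H) {g : α → G} (hg : MemLp g (ENNReal.ofReal (p / (p - 1))) μ) :
    Continuous fun f : Lp F (ENNReal.ofReal p) μ => ∫ x, B (f x) (g x) ∂μ := by
  obtain ⟨L, hL⟩ := exists_integral_lp_pairing B hg
  simpa only [← hL] using L.continuous

theorem IsTestFunction.memLp {φ : E n → ℝ} (hφ : IsTestFunction Ω φ) (q : ℝ≥0∞) :
    MemLp φ q (volume.restrict Ω) :=
  (hφ.smooth.continuous.memLp_of_hasCompactSupport hφ.hasCompactSupport).restrict _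

theorem IsTestFunction.memLp_gradient {φ : E n → ℝ} (hφ : IsTestFunction Ω φ) (q : ℝ≥0∞) :
    MemLp (gradient φ) q (volume.restrict Ω) :=
  (hφ.continuous_gradient.memLp_of_hasCompactSupport hφ.hasCompactSupport_gradient).restrict _

theorem isClosed_W1p : IsClosed (W1p Ω p : Set (LpPair Ω p)) := by
  have h : (W1p Ω p : Set (LpPair Ω p)) = ⋂ φ : E n → ℝ, ⋂ _ : IsTestFunction Ω φ,
      {w | ∫ x in Ω, w.1 x • gradient φ x = - ∫ x in Ω, φ x • w.2 x} := by
    ext w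
    simp only [Set.mem_iInter]
    rfl
  rw [h]
  refine isClosed_iInter fun φ => isClosed_iInter fun hφ => isClosed_eq ?_ ?_
  · exact (continuous_integral_lp_pairing (ContinuousLinearMap.lsmul ℝ ℝ)
      (hφ.memLp_gradient _)).comp continuous_fst
  · exact ((continuous_integral_lp_pairing (ContinuousLinearMap.lsmul ℝ ℝ).flip
      (hφ.memLp _)).comp continuous_snd).neg

instance completeSpace_W1p : CompleteSpace (W1p Ω p) :=
  isClosed_W1p.completeSpace_coe

theorem IsTestFunction.gradient_eq_zero {φ : E n → ℝ} (hφ : IsTestFunction Ω φ) {x : E n}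
    (hx : x ∉ Ω) : gradient φ x = 0 := by
  have : fderiv ℝ φ x = 0 := image_eq_zero_of_notMem_tsupport
    fun h => hx (hφ.tsupport_subset (tsupport_fderiv_subset ℝ h))
  simp [gradient, this]

/-- Both integrands vanish off Ω, so this is integration by parts on the whole space, applied after
pairing with a fixed vector. -/
theorem IsTestFunction.hasWeakGradient {φ : E n → ℝ} (hφ : IsTestFunction Ω φ) :
    HasWeakGradient Ω φ (gradient φ) := by
  intro ψ hψ
  have i1 {f g : E n → ℝ} (hf : IsTestFunction Ω f) (hg : IsTestFunction Ω g) :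
      Integrable fun x => f x • gradient g x :=
    (hf.smooth.continuous.smul hg.continuous_gradient).integrable_of_hasCompactSupport
      hf.hasCompactSupport.smul_right
  rw [setIntegral_eq_integral_of_forall_compl_eq_zero
      (fun x hx => by rw [hψ.gradient_eq_zero hx, smul_zero]),
    setIntegral_eq_integral_of_forall_compl_eq_zero
      (fun x hx => by rw [hφ.gradient_eq_zero hx, smul_zero])]
  refine ext_inner_left ℝ fun v => ?_
  rw [inner_neg_right, ← integral_inner (i1 hφ hψ), ← integral_inner (i1 hψ hφ)]
  have e (f : E n → ℝ) (x : E n) : inner ℝ v (gradient f x) = fderiv ℝ f x v := by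
    rw [real_inner_comm, gradient, InnerProductSpace.toDual_symm_apply]
  have i2 {f g : E n → ℝ} (hf : IsTestFunction Ω f) (hg : IsTestFunction Ω g) :
      Integrable fun x => f x * fderiv ℝ g x v := by
    refine ((i1 hf hg).const_inner v).congr (.of_forall fun x => ?_)
    simp only [inner_smul_right, e]
  simp only [inner_smul_right, e]
  rw [integral_mul_fderiv_eq_neg_fderiv_mul_of_integrable]
  · simp_rw [mul_comm]
  · simpa only [mul_comm] using i2 hψ hφ
  · exact i2 hφ hψ
  · exact (hφ.smooth.continuous.mul hψ.smooth.continuous).integrable_of_hasCompactSupport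
      hφ.hasCompactSupport.mul_right
  · exact fun x _ => hφ.differentiable x
  · exact fun x _ => hψ.differentiable x

/-- A test function defines an element of `W_0^{1,p}(Ω)`. -/
theorem IsTestFunction.exists_mem_W1p0 {φ : E n → ℝ} (hφ : IsTestFunction Ω φ) :
    ∃ w ∈ W1p0 Ω p, weakGrad w =ᵐ[volume.restrict Ω] gradient φ := by
  have h1 := (hφ.memLp (ENNReal.ofReal p)).coeFn_toLp
  have h2 := (hφ.memLp_gradient (ENNReal.ofReal p)).coeFn_toLp
  refine ⟨⟨((hφ.memLp _).toLp φ, (hφ.memLp_gradient _).toLp _), fun ψ hψ => ?_⟩,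
    subset_closure ⟨φ, hφ, h1, h2⟩, h2⟩
  refine (integral_congr_ae ?_).trans
    ((hφ.hasWeakGradient ψ hψ).trans (congrArg _ (integral_congr_ae ?_)))
  · filter_upwards [h1] with x hx
    simp only [hx]
  · filter_upwards [h2] with x hx
    simp only [hx]

theorem norm_gradient_eq (φ : E n → ℝ) (x : E n) : ‖gradient φ x‖ = ‖fderiv ℝ φ x‖ := by
  rw [gradient, LinearIsometryEquiv.norm_map]

/-- The Poincaré inequality for test functions on a bounded set. -/
theorem exists_poincare_test (hn : 2 ≤ n) (hΩb : Bornology.IsBounded Ω) (p : ℝ)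
    (hp : 1 < p) :
    ∃ C : ℝ≥0, ∀ φ : E n → ℝ, IsTestFunction Ω φ →
      eLpNorm φ (ENNReal.ofReal p) (volume.restrict Ω)
        ≤ C * eLpNorm (gradient φ) (ENNReal.ofReal p) (volume.restrict Ω) := by
  have hn' : (2 : ℝ) ≤ n := by exact_mod_cast hn
  have hp0 : 0 < p := by linarith
  -- The Sobolev inequality needs an exponent r < n. If p ≥ n, take 1/r = 1/p + 1/n, whose Sobolev
  -- conjugate is p; then r ≥ 1 because n ≥ 2.
  obtain ⟨r, hr1, hrn, hrp, hr⟩ : ∃ r : ℝ, 1 ≤ r ∧ r < n ∧ r ≤ p ∧ r⁻¹ - (n : ℝ)⁻¹ ≤ p⁻¹ := by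
    by_cases h : p < n
    · exact ⟨p, hp.le, h, le_rfl, by
        simp only [tsub_le_iff_right, le_add_iff_nonneg_right]; positivity⟩
    · push Not at h
      have h1 : (n : ℝ)⁻¹ ≤ 2⁻¹ := by gcongr
      have h2 : p⁻¹ ≤ 2⁻¹ := by gcongr; linarith
      have h3 : 0 < (n : ℝ)⁻¹ := by positivity
      have h4 : 0 < p⁻¹ := by positivity
      refine ⟨(p⁻¹ + (n : ℝ)⁻¹)⁻¹, ?_, ?_, ?_, ?_⟩
      · exact (one_le_inv₀ (by positivity)).2 (by linarith)
      · exact inv_lt_of_inv_lt₀ (by positivity) (by linarith)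
      · exact inv_le_of_inv_le₀ (by positivity) (by linarith)
      · rw [inv_inv]; linarith
  have hfin : volume Ω < ∞ := hΩb.measure_lt_top
  let C1 := eLpNormLESNormFDerivOfLeConst ℝ (volume : Measure (E n)) Ω r.toNNReal p.toNNReal
  -- Hölder's factor for passing from L^r to L^p on the finite-measure set Ω.
  let C2 := volume Ω ^ (1 / (ENNReal.ofReal r).toReal - 1 / (ENNReal.ofReal p).toReal)
  have hC2 : C2 ≠ ∞ := by
    refine ENNReal.rpow_ne_top_of_nonneg ?_ hfin.ne
    rw [ENNReal.toReal_ofReal (by linarith), ENNReal.toReal_ofReal hp0.le, sub_nonneg]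
    gcongr
  refine ⟨C1 * C2.toNNReal, fun φ hφ => ?_⟩
  have h1 := eLpNorm_le_eLpNorm_fderiv_of_le (volume : Measure (E n)) (u := φ) (s := Ω)
    (p := r.toNNReal) (q := p.toNNReal) (hφ.smooth.of_le (by exact_mod_cast le_top))
    ((subset_tsupport φ).trans hφ.tsupport_subset) (by simpa using hr1)
    (by rw [finrank_euclideanSpace_fin, Real.toNNReal_lt_iff_lt_coe (by linarith)]; simpa using hrn)
    (by rw [finrank_euclideanSpace_fin, NNReal.coe_inv, Real.coe_toNNReal _ hp0.le,
          Real.coe_toNNReal _ (by linarith)]; exact hr) hΩb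
  have h2 : eLpNorm (fderiv ℝ φ) (ENNReal.ofReal r) volume
      = eLpNorm (gradient φ) (ENNReal.ofReal r) (volume.restrict Ω) := by
    rw [eLpNorm_restrict_eq_of_support_subset]
    · exact eLpNorm_congr_norm_ae (.of_forall fun x => (norm_gradient_eq φ x).symm)
    · intro x hx
      by_contra h
      exact hx (hφ.gradient_eq_zero h)
  have h3 := eLpNorm_le_eLpNorm_mul_rpow_measure_univ (μ := volume.restrict Ω)
    (ENNReal.ofReal_le_ofReal hrp) (hφ.memLp_gradient 1).1
  rw [Measure.restrict_apply_univ] at h3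
  calc eLpNorm φ (ENNReal.ofReal p) (volume.restrict Ω)
      ≤ eLpNorm φ (ENNReal.ofReal p) volume := eLpNorm_mono_measure _ Measure.restrict_le_self
    _ ≤ C1 * eLpNorm (fderiv ℝ φ) (ENNReal.ofReal r) volume := h1
    _ ≤ C1 * (eLpNorm (gradient φ) (ENNReal.ofReal p) (volume.restrict Ω) * C2) := by
        rw [h2]; gcongr
    _ = _ := by rw [ENNReal.coe_mul, ENNReal.coe_toNNReal hC2]; ring

/-- The Poincaré inequality on `W_0^{1,p}(Ω)`. -/
theorem exists_poincare (hn : 2 ≤ n) (hΩb : Bornology.IsBounded Ω) (p : ℝ) [hp : Fact (1 < p)] :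
    ∃ C : ℝ, 0 ≤ C ∧ ∀ w ∈ W1p0 Ω p, ‖(w : LpPair Ω p)‖ ≤ C * ‖(w : LpPair Ω p).2‖ := by
  obtain ⟨C, hC⟩ := exists_poincare_test hn hΩb p hp.out
  have key : ∀ w ∈ W1p0 Ω p, ‖(w : LpPair Ω p).1‖ ≤ C * ‖(w : LpPair Ω p).2‖ := by
    have hcl : IsClosed {w : W1p Ω p | ‖(w : LpPair Ω p).1‖ ≤ C * ‖(w : LpPair Ω p).2‖} :=
      isClosed_le (by fun_prop) (by fun_prop)
    refine closure_minimal ?_ hcl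
    rintro w ⟨φ, hφ, h1, h2⟩
    have := hC φ hφ
    rw [← eLpNorm_congr_ae h1, ← eLpNorm_congr_ae h2] at this
    change ‖(w : LpPair Ω p).1‖ ≤ C * ‖(w : LpPair Ω p).2‖
    simp only [Lp.norm_def]
    rw [← ENNReal.coe_toReal, ← ENNReal.toReal_mul]
    exact ENNReal.toReal_mono (ENNReal.mul_ne_top ENNReal.coe_ne_top (Lp.eLpNorm_ne_top _)) this
  refine ⟨max C 1, by positivity, fun w hw => ?_⟩
  rw [Prod.norm_def]
  refine max_le ((key w hw).trans ?_) ?_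
  · gcongr; exact le_max_left _ _
  · exact le_mul_of_one_le_left (norm_nonneg _) (le_max_right _ _)

end sobolev

/-! ### The energy, its weak form and its convexity. -/

section energy

open Filter Topology
open scoped ENNReal NNReal

variable {n : ℕ} {Ω : Set (E n)} {p : ℝ} [hp : Fact (1 < p)]

theorem weakGrad_add (u v : W1p Ω p) :
    weakGrad (u + v) =ᵐ[volume.restrict Ω] weakGrad u + weakGrad v := Lp.coeFn_add _ _

theorem weakGrad_sub (u v : W1p Ω p) :
    weakGrad (u - v) =ᵐ[volume.restrict Ω] weakGrad u - weakGrad v := Lp.coeFn_sub _ _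

theorem weakGrad_smul (c : ℝ) (u : W1p Ω p) :
    weakGrad (c • u) =ᵐ[volume.restrict Ω] c • weakGrad u := Lp.coeFn_smul _ _

theorem memLp_weakGrad (u : W1p Ω p) :
    MemLp (weakGrad u) (ENNReal.ofReal p) (volume.restrict Ω) := Lp.memLp _

theorem aestronglyMeasurable_of_mem_LinftyPos {σ : E n → ℝ} (hσ : σ ∈ LinftyPos Ω) :
    AEStronglyMeasurable σ (volume.restrict Ω) := hσ.1.1

theorem exists_bounds_of_mem_LinftyPos {σ : E n → ℝ} (hσ : σ ∈ LinftyPos Ω) :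
    ∃ ε M : ℝ, 0 < ε ∧ 0 < M ∧ ∀ᵐ x ∂(volume.restrict Ω), ε < σ x ∧ σ x ≤ M := by
  obtain ⟨h, ε, hε, hlow⟩ := hσ
  have h1 := ae_le_eLpNormEssSup (f := σ) (μ := volume.restrict Ω)
  have h2 : eLpNormEssSup σ (volume.restrict Ω) ≠ ∞ := by
    simpa using h.2.ne
  refine ⟨ε, (eLpNormEssSup σ (volume.restrict Ω)).toReal + 1, hε, by positivity, ?_⟩
  filter_upwards [hlow, h1] with x hx hx1
  have h3 : ‖σ x‖ ≤ (eLpNormEssSup σ (volume.restrict Ω)).toReal := by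
    rw [← toReal_enorm]
    exact ENNReal.toReal_mono h2 hx1
  exact ⟨hx, by linarith [Real.le_norm_self (σ x)]⟩

theorem integrable_norm_rpow {G : E n → E n}
    (hG : MemLp G (ENNReal.ofReal p) (volume.restrict Ω)) :
    Integrable (fun x => ‖G x‖ ^ p) (volume.restrict Ω) := by
  have hp0 : 0 < p := by linarith [hp.out]
  simpa [ENNReal.toReal_ofReal hp0.le] using
    hG.integrable_norm_rpow (by simpa using hp0) ENNReal.ofReal_ne_top

theorem integrable_mul_norm_rpow {c : E n → ℝ} {M : ℝ}
    (hc : AEStronglyMeasurable c (volume.restrict Ω))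
    (hM : ∀ᵐ x ∂(volume.restrict Ω), ‖c x‖ ≤ M) {G : E n → E n}
    (hG : MemLp G (ENNReal.ofReal p) (volume.restrict Ω)) :
    Integrable (fun x => c x * ‖G x‖ ^ p) (volume.restrict Ω) :=
  (integrable_norm_rpow hG).bdd_mul hc hM

theorem integrable_energy_density {σ : E n → ℝ} (hσ : σ ∈ LinftyPos Ω) {G : E n → E n}
    (hG : MemLp G (ENNReal.ofReal p) (volume.restrict Ω)) :
    Integrable (fun x => σ x * ‖G x‖ ^ p) (volume.restrict Ω) := by
  obtain ⟨ε, M, hε, hM, h⟩ := exists_bounds_of_mem_LinftyPos hσ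
  refine integrable_mul_norm_rpow (M := M) (aestronglyMeasurable_of_mem_LinftyPos hσ) ?_ hG
  filter_upwards [h] with x hx
  rw [Real.norm_of_nonneg (by linarith)]
  exact hx.2

/-- The flux has norm σ|∇u|^(p-1), and raising |∇u|^(p-1) to the conjugate exponent p/(p-1) gives
|∇u|^p. -/
theorem memLp_flux {σ : E n → ℝ} (hσ : σ ∈ LinftyPos Ω) (u : W1p Ω p) :
    MemLp (flux σ u) (ENNReal.ofReal (p / (p - 1))) (volume.restrict Ω) := by
  have hp0 : 0 < p - 1 := by linarith [hp.out]
  obtain ⟨ε, M, hε, hM, h⟩ := exists_bounds_of_mem_LinftyPos hσ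
  have h1 := (memLp_weakGrad u).norm_rpow_div (ENNReal.ofReal (p - 1))
  rw [ENNReal.toReal_ofReal hp0.le, ← ENNReal.ofReal_div_of_pos hp0] at h1
  refine h1.of_le_mul (c := M) ?_ ?_
  · exact ((aestronglyMeasurable_of_mem_LinftyPos hσ).mul
      ((memLp_weakGrad u).1.norm.aemeasurable.pow_const _).aestronglyMeasurable).smul
      (memLp_weakGrad u).1
  · filter_upwards [h] with x hx
    rw [flux, ← smul_smul, norm_smul, norm_rpow_smul_self hp.out,
      Real.norm_of_nonneg (by linarith), Real.norm_of_nonneg (by positivity)]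
    gcongr
    exact hx.2

/-- The weak form `∫_Ω σ |∇u|^{p-2} ∇u · ∇v`. -/
def fluxPairing (σ : E n → ℝ) (u v : W1p Ω p) : ℝ :=
  ∫ x in Ω, inner ℝ (flux σ u x) (weakGrad v x)

/-- The `p`-Dirichlet energy `∫_Ω σ |∇u|^p`. -/
def energy (σ : E n → ℝ) (u : W1p Ω p) : ℝ := ∫ x in Ω, σ x * ‖weakGrad u x‖ ^ p

/-- The pairing is nonlinear in u but linear and bounded in v, by Hölder; the functional supplies
both the algebra in v and the limit arguments below. -/
theorem exists_fluxPairing_clm {σ : E n → ℝ} (hσ : σ ∈ LinftyPos Ω) (u : W1p Ω p) :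
    ∃ L : W1p Ω p →L[ℝ] ℝ, ∀ v, L v = fluxPairing σ u v := by
  obtain ⟨L, hL⟩ := exists_integral_lp_pairing (innerSL ℝ : E n →L[ℝ] E n →L[ℝ] ℝ)
    (memLp_flux hσ u)
  refine ⟨L ∘L ContinuousLinearMap.snd ℝ _ _ ∘L (W1p Ω p).subtypeL, fun v => ?_⟩
  refine (hL _).trans (integral_congr_ae (.of_forall fun x => ?_))
  exact real_inner_comm (flux σ u x) (weakGrad v x)

theorem fluxPairing_sub {σ : E n → ℝ} (hσ : σ ∈ LinftyPos Ω) (u v w : W1p Ω p) :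
    fluxPairing σ u (v - w) = fluxPairing σ u v - fluxPairing σ u w := by
  obtain ⟨L, hL⟩ := exists_fluxPairing_clm hσ u
  rw [← hL, ← hL, ← hL, map_sub]

theorem fluxPairing_neg {σ : E n → ℝ} (hσ : σ ∈ LinftyPos Ω) (u v : W1p Ω p) :
    fluxPairing σ u (-v) = -fluxPairing σ u v := by
  obtain ⟨L, hL⟩ := exists_fluxPairing_clm hσ u
  rw [← hL, ← hL, map_neg]

theorem fluxPairing_smul {σ : E n → ℝ} (hσ : σ ∈ LinftyPos Ω) (u v : W1p Ω p) (c : ℝ) :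
    fluxPairing σ u (c • v) = c * fluxPairing σ u v := by
  obtain ⟨L, hL⟩ := exists_fluxPairing_clm hσ u
  rw [← hL, ← hL, map_smul, smul_eq_mul]

theorem inner_flux (σ : E n → ℝ) (u : W1p Ω p) (x a : E n) :
    inner ℝ (flux σ u x) a
      = σ x * ‖weakGrad u x‖ ^ (p - 2) * inner ℝ (weakGrad u x) a := by
  rw [flux, real_inner_smul_left]

theorem fluxPairing_self (σ : E n → ℝ) (u : W1p Ω p) : fluxPairing σ u u = energy σ u := by
  refine integral_congr_ae (.of_forall fun x => ?_)
  simp only [inner_flux, mul_assoc, norm_rpow_mul_inner_self hp.out]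

theorem integrable_fluxPairing {σ : E n → ℝ} (hσ : σ ∈ LinftyPos Ω) (u v : W1p Ω p) :
    Integrable (fun x => inner ℝ (flux σ u x) (weakGrad v x)) (volume.restrict Ω) := by
  have := (holderConjugate_ofReal p).symm
  exact memLp_one_iff_integrable.1 ((innerSL ℝ : E n →L[ℝ] E n →L[ℝ] ℝ).memLp_of_bilin 1
    (memLp_flux hσ u) (memLp_weakGrad v))

theorem energy_nonneg {σ : E n → ℝ} (hσ : σ ∈ LinftyPos Ω) (u : W1p Ω p) : 0 ≤ energy σ u := by
  obtain ⟨ε, M, hε, hM, h⟩ := exists_bounds_of_mem_LinftyPos hσ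
  refine integral_nonneg_of_ae ?_
  filter_upwards [h] with x hx
  have : 0 < σ x := by linarith
  positivity

/-- The weak form is a subgradient of the energy. -/
theorem energy_subgradient {σ : E n → ℝ} (hσ : σ ∈ LinftyPos Ω) (u v : W1p Ω p) :
    energy σ u + p * fluxPairing σ u (v - u) ≤ energy σ v := by
  obtain ⟨ε, M, hε, hM, h⟩ := exists_bounds_of_mem_LinftyPos hσ
  rw [energy, fluxPairing, ← integral_const_mul, ← integral_add (integrable_energy_density hσ (memLp_weakGrad u))
    ((integrable_fluxPairing hσ u _).const_mul _)]
  refine integral_mono_ae ((integrable_energy_density hσ (memLp_weakGrad u)).add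
    ((integrable_fluxPairing hσ u _).const_mul _)) (integrable_energy_density hσ (memLp_weakGrad v)) ?_
  filter_upwards [h, weakGrad_sub v u] with x hx hsub
  have hx0 : 0 < σ x := by linarith
  simp only [inner_flux, hsub, Pi.sub_apply]
  have := mul_le_mul_of_nonneg_left
    (rpow_norm_subgradient hp.out (weakGrad v x) (weakGrad u x)) hx0.le
  linarith

theorem lower_bound_energy {σ : E n → ℝ} (hσ : σ ∈ LinftyPos Ω) :
    ∃ ε > 0, ∀ u : W1p Ω p, ε * ‖(u : LpPair Ω p).2‖ ^ p ≤ energy σ u := by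
  have hp0 : 0 < p := by linarith [hp.out]
  obtain ⟨ε, M, hε, hM, h⟩ := exists_bounds_of_mem_LinftyPos hσ
  refine ⟨ε, hε, fun u => ?_⟩
  have h1 : ‖(u : LpPair Ω p).2‖ ^ p = ∫ x in Ω, ‖weakGrad u x‖ ^ p := by
    have h0 : 0 ≤ ∫ x in Ω, ‖weakGrad u x‖ ^ p := integral_nonneg fun x => by positivity
    rw [Lp.norm_def, (Lp.memLp _).eLpNorm_eq_integral_rpow_norm (by simpa using hp0)
      ENNReal.ofReal_ne_top, ENNReal.toReal_ofReal hp0.le]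
    change (ENNReal.ofReal ((∫ x in Ω, ‖weakGrad u x‖ ^ p) ^ p⁻¹)).toReal ^ p = _
    rw [ENNReal.toReal_ofReal (Real.rpow_nonneg h0 _)]
    exact Real.rpow_inv_rpow h0 hp0.ne'
  rw [h1, ← integral_const_mul]
  refine integral_mono_ae ((integrable_norm_rpow (memLp_weakGrad u)).const_mul _)
    (integrable_energy_density hσ (memLp_weakGrad u)) ?_
  filter_upwards [h] with x hx
  have := hx.1.le
  gcongr

/-- A quantitative form of the strict convexity of the energy. -/
theorem exists_energy_sub_le {σ : E n → ℝ} (hσ : σ ∈ LinftyPos Ω) {η : ℝ} (hη : 0 < η) :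
    ∃ c : ℝ, 0 ≤ c ∧ ∀ u v : W1p Ω p, energy σ (u - v) ≤ η * (energy σ u + energy σ v)
      + c * ((energy σ u + energy σ v) / 2 - energy σ ((1 / 2 : ℝ) • (u + v))) := by
  obtain ⟨ε, M, hε, hM, h⟩ := exists_bounds_of_mem_LinftyPos hσ
  obtain ⟨c, hc, hcV⟩ := exists_norm_sub_rpow_le (V := E n) hp.out hη
  refine ⟨c, hc, fun u v => ?_⟩
  have i (w : W1p Ω p) := integrable_energy_density hσ (memLp_weakGrad w)
  have i1 : Integrable (fun x => η * (σ x * ‖weakGrad u x‖ ^ p + σ x * ‖weakGrad v x‖ ^ p))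
      (volume.restrict Ω) := ((i u).add (i v)).const_mul _
  have i2 : Integrable (fun x => (σ x * ‖weakGrad u x‖ ^ p + σ x * ‖weakGrad v x‖ ^ p) / 2)
      (volume.restrict Ω) := ((i u).add (i v)).div_const _
  have i3 : Integrable (fun x => c * ((σ x * ‖weakGrad u x‖ ^ p + σ x * ‖weakGrad v x‖ ^ p) / 2
      - σ x * ‖weakGrad ((1 / 2 : ℝ) • (u + v)) x‖ ^ p)) (volume.restrict Ω) :=
    (i2.sub (i _)).const_mul _
  simp only [energy]
  rw [← integral_add (i u) (i v), ← integral_const_mul, ← integral_div,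
    ← integral_sub i2 (i _), ← integral_const_mul, ← integral_add i1 i3]
  refine integral_mono_ae (i _) (i1.add i3) ?_
  filter_upwards [h, weakGrad_sub u v, weakGrad_smul (1 / 2) (u + v), weakGrad_add u v]
    with x hx h1 h2 h3
  have hx0 : 0 < σ x := by linarith
  simp only [h1, h2, h3, Pi.sub_apply, Pi.smul_apply, Pi.add_apply]
  have := mul_le_mul_of_nonneg_left (hcV (weakGrad u x) (weakGrad v x)) hx0.le
  linarith

end energy

/-! ### Minimizers, weak solutions and the Dirichlet-to-Neumann map. -/

section dirichlet

open Filter Topology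
open scoped ENNReal NNReal

variable {n : ℕ} {Ω : Set (E n)} {p : ℝ} [hp : Fact (1 < p)]

/-- On `W_0^{1,p}(Ω)`, small energy implies small norm. -/
theorem exists_norm_lt_of_energy_lt (hn : 2 ≤ n) (hΩb : Bornology.IsBounded Ω) {σ : E n → ℝ}
    (hσ : σ ∈ LinftyPos Ω) {δ : ℝ} (hδ : 0 < δ) :
    ∃ τ > 0, ∀ w ∈ W1p0 Ω p, energy σ w < τ → ‖w‖ < δ := by
  have hp0 : 0 < p := by linarith [hp.out]
  obtain ⟨C, hC, hCw⟩ := exists_poincare hn hΩb p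
  obtain ⟨ε, hε, hεw⟩ := lower_bound_energy (p := p) hσ
  -- Coercivity then forces ‖∇w‖ < δ/(C + 1), and Poincaré concludes; C + 1 avoids division by zero.
  refine ⟨ε * (δ / (C + 1)) ^ p, by positivity, fun w hw h => ?_⟩
  have h1 := lt_of_mul_lt_mul_left ((hεw w).trans_lt h) hε.le
  have h2 := (Real.rpow_lt_rpow_iff (norm_nonneg _) (by positivity) hp0).1 h1
  calc ‖w‖ ≤ C * ‖(w : LpPair Ω p).2‖ := hCw w hw
    _ ≤ (C + 1) * ‖(w : LpPair Ω p).2‖ := by gcongr; linarith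
    _ < (C + 1) * (δ / (C + 1)) := by gcongr
    _ = δ := by field_simp

/-- Near-minimizers of the energy in a class of functions with the same boundary values are close
to each other. -/
theorem exists_norm_sub_lt_of_near_minimizer (hn : 2 ≤ n) (hΩb : Bornology.IsBounded Ω)
    {σ : E n → ℝ} (hσ : σ ∈ LinftyPos Ω) (f : W1p Ω p) {m : ℝ} (hm0 : 0 ≤ m)
    (hm : ∀ u, u - f ∈ W1p0 Ω p → m ≤ energy σ u) {δ : ℝ} (hδ : 0 < δ) :
    ∃ θ > 0, ∀ u v, u - f ∈ W1p0 Ω p → v - f ∈ W1p0 Ω p → energy σ u < m + θ →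
      energy σ v < m + θ → ‖u - v‖ < δ := by
  obtain ⟨τ, hτ, hτw⟩ := exists_norm_lt_of_energy_lt (p := p) hn hΩb hσ hδ
  -- Each of the two terms should cost at most τ/2. Since θ ≤ 1, the energies sum to less than 2(m +
  -- 1), whence η. The midpoint is admissible, so its energy is at least m and the gap is below θ,
  -- whence the second bound on θ.
  obtain ⟨c, hc, hcw⟩ := exists_energy_sub_le (p := p) hσ (η := τ / (4 * (m + 1)))
    (by positivity)
  refine ⟨min 1 (τ / (2 * (c + 1))), by positivity, fun u v hu hv h1 h2 => ?_⟩
  have hθ1 := min_le_left 1 (τ / (2 * (c + 1)))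
  have hθ2 := min_le_right 1 (τ / (2 * (c + 1)))
  have hmid : (1 / 2 : ℝ) • (u + v) - f ∈ W1p0 Ω p := by
    have : (1 / 2 : ℝ) • (u + v) - f = (1 / 2 : ℝ) • ((u - f) + (v - f)) := by module
    rw [this]
    exact Submodule.smul_mem _ _ (Submodule.add_mem _ hu hv)
  have h3 := hm _ hmid
  refine hτw _ ?_ ((hcw u v).trans_lt ?_)
  · have : u - v = (u - f) - (v - f) := by abel
    rw [this]
    exact Submodule.sub_mem _ hu hv
  · have h4 : τ / (4 * (m + 1)) * (energy σ u + energy σ v) < τ / (4 * (m + 1)) * (2 * (m + 1)) := by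
      gcongr
      linarith
    have h5 : τ / (4 * (m + 1)) * (2 * (m + 1)) = τ / 2 := by field_simp; norm_num
    have h6 : c * ((energy σ u + energy σ v) / 2 - energy σ ((1 / 2 : ℝ) • (u + v)))
        ≤ (c + 1) * (τ / (2 * (c + 1))) := by
      refine (mul_le_mul_of_nonneg_left (b := _) (c := τ / (2 * (c + 1))) (by linarith) hc).trans ?_
      gcongr
      linarith
    have h7 : (c + 1) * (τ / (2 * (c + 1))) = τ / 2 := by field_simp
    linarith

/-- Minimizers of the energy with given boundary values are unique. -/
theorem minimizer_unique (hn : 2 ≤ n) (hΩb : Bornology.IsBounded Ω)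
    {σ : E n → ℝ} (hσ : σ ∈ LinftyPos Ω) {f u v : W1p Ω p} (hu : u - f ∈ W1p0 Ω p)
    (hv : v - f ∈ W1p0 Ω p) (hum : ∀ w, w - f ∈ W1p0 Ω p → energy σ u ≤ energy σ w)
    (hvm : ∀ w, w - f ∈ W1p0 Ω p → energy σ v ≤ energy σ w) : u = v := by
  rw [← sub_eq_zero, ← norm_le_zero_iff]
  refine le_of_forall_pos_lt_add fun δ hδ => ?_
  obtain ⟨θ, hθ, h⟩ := exists_norm_sub_lt_of_near_minimizer hn hΩb hσ f (energy_nonneg hσ u) hum hδ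
  rw [zero_add]
  exact h u v hu hv (by linarith) (by linarith [hvm u hu])

theorem isClosed_W1p0 : IsClosed (W1p0 Ω p : Set (W1p Ω p)) :=
  Submodule.isClosed_topologicalClosure _

/-- The energy attains its minimum among functions with given boundary values. -/
theorem exists_minimizer (hn : 2 ≤ n) (hΩb : Bornology.IsBounded Ω)
    {σ : E n → ℝ} (hσ : σ ∈ LinftyPos Ω) (f : W1p Ω p) :
    ∃ u, u - f ∈ W1p0 Ω p ∧ ∀ v, v - f ∈ W1p0 Ω p → energy σ u ≤ energy σ v := by
  let S : Set ℝ := energy σ '' {u : W1p Ω p | u - f ∈ W1p0 Ω p}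
  have hSn : S.Nonempty := ⟨_, f, by simp, rfl⟩
  have hSb : BddBelow S := ⟨0, by rintro _ ⟨u, _, rfl⟩; exact energy_nonneg hσ u⟩
  set m := sInf S
  have hm0 : 0 ≤ m := le_csInf hSn (by rintro _ ⟨u, _, rfl⟩; exact energy_nonneg hσ u)
  have hm : ∀ u : W1p Ω p, u - f ∈ W1p0 Ω p → m ≤ energy σ u :=
    fun u hu => csInf_le hSb ⟨u, hu, rfl⟩
  have hseq : ∀ k : ℕ, ∃ u : W1p Ω p, u - f ∈ W1p0 Ω p ∧ energy σ u < m + 1 / ((k : ℝ) + 1) := by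
    intro k
    obtain ⟨_, ⟨u, hu, rfl⟩, h⟩ := exists_lt_of_csInf_lt hSn
      (show sInf S < m + 1 / ((k : ℝ) + 1) from lt_add_of_pos_right _ (by positivity))
    exact ⟨u, hu, h⟩
  choose u hu hum using hseq
  have hlim : Tendsto (fun k : ℕ => m + 1 / ((k : ℝ) + 1)) atTop (𝓝 m) := by
    simpa using tendsto_one_div_add_atTop_nhds_zero_nat.const_add m
  have hcauchy : CauchySeq u := by
    rw [Metric.cauchySeq_iff]
    intro δ hδ
    obtain ⟨θ, hθ, h⟩ := exists_norm_sub_lt_of_near_minimizer hn hΩb hσ f hm0 hm hδ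
    obtain ⟨N, hN⟩ := eventually_atTop.1 (hlim.eventually_lt_const (lt_add_of_pos_right m hθ))
    refine ⟨N, fun k hk l hl => ?_⟩
    rw [dist_eq_norm]
    exact h _ _ (hu k) (hu l) ((hum k).trans (hN k hk)) ((hum l).trans (hN l hl))
  obtain ⟨w, hw⟩ := cauchySeq_tendsto_of_complete hcauchy
  refine ⟨w, isClosed_W1p0.mem_of_tendsto (hw.sub_const f) (.of_forall hu), fun v hv => ?_⟩
  refine le_trans ?_ (hm v hv)
  -- Lower semicontinuity along the sequence: the energy lies above its linearization at w, which
  -- tends to the energy of w.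
  obtain ⟨L, hL⟩ := exists_fluxPairing_clm hσ w
  have h1 : Tendsto (fun k => energy σ w + p * L (u k - w)) atTop (𝓝 (energy σ w)) := by
    have := (((L.continuous.tendsto _).comp (hw.sub_const w)).const_mul p).const_add (energy σ w)
    simpa using this
  refine le_of_tendsto_of_tendsto' h1 hlim fun k => ?_
  rw [hL]
  exact (energy_subgradient hσ w (u k)).trans (hum k).le

/-- The first variation of the energy at a minimizer vanishes. -/
theorem fluxPairing_nonneg_of_minimizer {σ : E n → ℝ} (hσ : σ ∈ LinftyPos Ω) {u w : W1p Ω p}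
    (hmin : ∀ t : ℝ, energy σ u ≤ energy σ (u + t • w)) : 0 ≤ fluxPairing σ u w := by
  have hp1 := hp.out
  have hpos : ∀ k : ℕ, 0 ≤ fluxPairing σ (u + (1 / ((k : ℝ) + 1)) • w) w := by
    intro k
    have ht : 0 < 1 / ((k : ℝ) + 1) := by positivity
    set t := 1 / ((k : ℝ) + 1)
    -- Linearizing at the shifted point and comparing with u gives the sign without differentiating
    -- the energy; then t → 0 by dominated convergence.
    have h1 := energy_subgradient hσ (u + t • w) u
    have h2 : u - (u + t • w) = -(t • w) := by abel
    rw [h2, fluxPairing_neg hσ, fluxPairing_smul hσ] at h1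
    have h3 : 0 ≤ p * (t * fluxPairing σ (u + t • w) w) := by linarith [hmin t]
    have h4 : 0 < p * t := by positivity
    rw [← mul_assoc] at h3
    exact nonneg_of_mul_nonneg_right h3 h4
  refine ge_of_tendsto' (f := fun k : ℕ => fluxPairing σ (u + (1 / ((k : ℝ) + 1)) • w) w)
    (x := atTop) ?_ hpos
  obtain ⟨ε, M, hε, hM, h⟩ := exists_bounds_of_mem_LinftyPos hσ
  have hgrad : ∀ᵐ x ∂(volume.restrict Ω), ∀ k : ℕ,
      weakGrad (u + (1 / ((k : ℝ) + 1)) • w) x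
        = weakGrad u x + (1 / ((k : ℝ) + 1)) • weakGrad w x := by
    refine ae_all_iff.2 fun k => ?_
    filter_upwards [weakGrad_add u ((1 / ((k : ℝ) + 1)) • w), weakGrad_smul (1 / ((k : ℝ) + 1)) w]
      with x h1 h2
    rw [h1, Pi.add_apply, h2, Pi.smul_apply]
  have hbound : Integrable (fun x => M * (‖weakGrad u x‖ + ‖weakGrad w x‖) ^ p)
      (volume.restrict Ω) := by
    have h1 : MemLp (fun x => ‖weakGrad u x‖ + ‖weakGrad w x‖) (ENNReal.ofReal p)
        (volume.restrict Ω) := (memLp_weakGrad u).norm.add (memLp_weakGrad w).norm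
    have h2 := h1.integrable_norm_rpow (by simpa using by linarith) ENNReal.ofReal_ne_top
    rw [ENNReal.toReal_ofReal (by linarith)] at h2
    refine (h2.congr (.of_forall fun x => ?_)).const_mul M
    simp only
    rw [Real.norm_of_nonneg (by positivity)]
  refine tendsto_integral_of_dominated_convergence _
    (fun k => (integrable_fluxPairing hσ _ w).1) hbound (fun k => ?_) ?_
  · filter_upwards [h, hgrad] with x hx hg
    have hσ0 : 0 < σ x := by linarith
    have ht1 : 1 / ((k : ℝ) + 1) ≤ 1 := by
      rw [div_le_one (by positivity)]
      linarith [k.cast_nonneg (α := ℝ)]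
    have hle : ‖weakGrad (u + (1 / ((k : ℝ) + 1)) • w) x‖ ≤ ‖weakGrad u x‖ + ‖weakGrad w x‖ := by
      rw [hg k]
      refine (norm_add_le _ _).trans ?_
      rw [norm_smul, Real.norm_of_nonneg (by positivity)]
      gcongr
      exact mul_le_of_le_one_left (norm_nonneg _) ht1
    have hs : 0 ≤ ‖weakGrad u x‖ + ‖weakGrad w x‖ := by positivity
    calc ‖inner ℝ (flux σ (u + (1 / ((k : ℝ) + 1)) • w) x) (weakGrad w x)‖
        ≤ ‖flux σ (u + (1 / ((k : ℝ) + 1)) • w) x‖ * ‖weakGrad w x‖ := norm_inner_le_norm _ _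
      _ = σ x * ‖weakGrad (u + (1 / ((k : ℝ) + 1)) • w) x‖ ^ (p - 1) * ‖weakGrad w x‖ := by
          rw [flux, ← smul_smul, norm_smul, norm_rpow_smul_self hp1, Real.norm_of_nonneg hσ0.le]
      _ ≤ M * (‖weakGrad u x‖ + ‖weakGrad w x‖) ^ (p - 1)
            * (‖weakGrad u x‖ + ‖weakGrad w x‖) := by
          gcongr
          · exact hx.2
          · linarith [norm_nonneg (weakGrad u x)]
      _ = M * (‖weakGrad u x‖ + ‖weakGrad w x‖) ^ p := by
          rw [mul_assoc, ← Real.rpow_add_one' hs (by linarith), sub_add_cancel]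
  · filter_upwards [hgrad] with x hg
    have h0 : Tendsto (fun k : ℕ => weakGrad (u + (1 / ((k : ℝ) + 1)) • w) x) atTop
        (𝓝 (weakGrad u x)) := by
      have hlim (a b : E n) : Tendsto (fun k : ℕ => a + (1 / ((k : ℝ) + 1)) • b) atTop (𝓝 a) := by
        have h1 : Tendsto (fun k : ℕ => a + (1 / ((k : ℝ) + 1)) • b) atTop
            (𝓝 (a + (0 : ℝ) • b)) :=
          tendsto_const_nhds.add (tendsto_one_div_add_atTop_nhds_zero_nat.smul_const b)
        rwa [zero_smul, add_zero] at h1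
      exact (hlim _ _).congr fun k => (hg k).symm
    have h1 : Continuous fun b : E n =>
        inner ℝ ((σ x * ‖b‖ ^ (p - 2)) • b) (weakGrad w x) := by
      simp_rw [← smul_smul]
      exact ((continuous_norm_rpow_smul hp1).const_smul (σ x)).inner continuous_const
    exact (h1.tendsto _).comp h0

theorem trace_eq_iff {u f : W1p Ω p} : trace u = trace f ↔ u - f ∈ W1p0 Ω p :=
  Submodule.Quotient.eq _

/-- A distributional solution can be tested against all of `W_0^{1,p}(Ω)`. -/
theorem IsWeakSolution.fluxPairing_eq_zero {σ : E n → ℝ} (hσ : σ ∈ LinftyPos Ω) {u : W1p Ω p}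
    (hu : IsWeakSolution σ u) {w : W1p Ω p} (hw : w ∈ W1p0 Ω p) : fluxPairing σ u w = 0 := by
  obtain ⟨L, hL⟩ := exists_fluxPairing_clm hσ u
  have hcl : IsClosed {w : W1p Ω p | fluxPairing σ u w = 0} := by
    simp_rw [← hL]
    exact isClosed_eq L.continuous continuous_const
  refine closure_minimal ?_ hcl hw
  rintro w ⟨φ, hφ, -, h2⟩
  refine (integral_congr_ae ?_).trans (hu φ hφ)
  filter_upwards [h2] with x hx
  rw [weakGrad, hx]

theorem SolvesDirichlet.energy_le {σ : E n → ℝ} (hσ : σ ∈ LinftyPos Ω) {f u v : W1p Ω p}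
    (hu : SolvesDirichlet σ (trace f) u) (hv : v - f ∈ W1p0 Ω p) : energy σ u ≤ energy σ v := by
  have h := energy_subgradient hσ u v
  rwa [hu.1.fluxPairing_eq_zero hσ (trace_eq_iff.1 ((trace_eq_iff.2 hv).trans hu.2.symm)),
    mul_zero, add_zero] at h

theorem existsUnique_solvesDirichlet (hn : 2 ≤ n) (hΩb : Bornology.IsBounded Ω)
    {σ : E n → ℝ} (hσ : σ ∈ LinftyPos Ω) (F : TraceSpace Ω p) :
    ∃! u : W1p Ω p, SolvesDirichlet σ F u := by
  obtain ⟨f, rfl⟩ : ∃ f : W1p Ω p, trace f = F := Submodule.mkQ_surjective _ F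
  obtain ⟨u, huf, hmin⟩ := exists_minimizer hn hΩb hσ f
  refine ⟨u, ⟨fun φ hφ => ?_, trace_eq_iff.2 huf⟩, fun v hv => ?_⟩
  · obtain ⟨w, hw, hwφ⟩ := hφ.exists_mem_W1p0 (p := p)
    have hmem : ∀ z ∈ W1p0 Ω p, ∀ t : ℝ, energy σ u ≤ energy σ (u + t • z) := by
      intro z hz t
      refine hmin _ ?_
      rw [add_sub_right_comm]
      exact Submodule.add_mem _ huf (Submodule.smul_mem _ _ hz)
    -- Using both w and -w turns the one-sided condition into an equality.
    have h1 := fluxPairing_nonneg_of_minimizer hσ (hmem w hw)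
    have h2 := fluxPairing_nonneg_of_minimizer hσ (hmem (-w) (Submodule.neg_mem _ hw))
    rw [fluxPairing_neg hσ] at h2
    have h3 : fluxPairing σ u w = 0 := by linarith
    rw [← h3]
    refine integral_congr_ae ?_
    filter_upwards [hwφ] with x hx
    rw [hx]
  · exact minimizer_unique hn hΩb hσ (trace_eq_iff.1 hv.2) huf
      (fun w hw => hv.energy_le hσ hw) hmin

theorem dnMap_trace (hn : 2 ≤ n) (hΩb : Bornology.IsBounded Ω)
    {σ : E n → ℝ} (hσ : σ ∈ LinftyPos Ω) {F : TraceSpace Ω p} {u : W1p Ω p}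
    (hu : SolvesDirichlet σ F u) (v : W1p Ω p) :
    dnMap σ F (trace v) = fluxPairing σ u v := by
  obtain ⟨L, hL⟩ := exists_fluxPairing_clm hσ u
  have hex : ∃ ℓ, IsDNValue σ F ℓ := by
    -- The weak form vanishes on W_0^{1,p}, so it descends to the trace space.
    refine ⟨(W1p0 Ω p).liftQL L fun w hw => ?_, u, hu, fun v => ?_⟩
    · rw [LinearMap.mem_ker]
      exact (hL w).trans (hu.1.fluxPairing_eq_zero hσ hw)
    · exact hL v
  obtain ⟨u', hu', h⟩ := hex.choose_spec
  -- The chosen functional comes with its own solution, which uniqueness identifies with u.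
  rw [(existsUnique_solvesDirichlet hn hΩb hσ F).unique hu' hu] at h
  rw [dnMap, dif_pos hex]
  exact h v

theorem dnMap_trace_self (hn : 2 ≤ n) (hΩb : Bornology.IsBounded Ω)
    {σ : E n → ℝ} (hσ : σ ∈ LinftyPos Ω) {f u : W1p Ω p}
    (hu : SolvesDirichlet σ (trace f) u) : dnMap σ (trace f) (trace f) = energy σ u := by
  rw [dnMap_trace hn hΩb hσ hu, ← fluxPairing_self, ← sub_eq_zero, ← fluxPairing_sub hσ]
  exact hu.1.fluxPairing_eq_zero hσ (trace_eq_iff.1 hu.2.symm)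

/-- Comparison of the weak form for `σ₀` with the energy for `σ₁`. -/
theorem mul_fluxPairing_le {σ₀ σ₁ : E n → ℝ} (h₀ : σ₀ ∈ LinftyPos Ω) (h₁ : σ₁ ∈ LinftyPos Ω)
    (u v : W1p Ω p) :
    (p - 1) * (∫ x in Ω, σ₀ x / σ₁ x ^ (1 / (p - 1))
          * (σ₁ x ^ (1 / (p - 1)) - σ₀ x ^ (1 / (p - 1))) * ‖weakGrad u x‖ ^ p)
      ≤ energy σ₁ v - p * fluxPairing σ₀ u v + (p - 1) * energy σ₀ u := by
  have hp1 := hp.out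
  have hp' : 0 < p - 1 := by linarith
  obtain ⟨ε₀, M₀, hε₀, hM₀, hb₀⟩ := exists_bounds_of_mem_LinftyPos h₀
  obtain ⟨ε₁, M₁, hε₁, hM₁, hb₁⟩ := exists_bounds_of_mem_LinftyPos h₁
  have m₀ := aestronglyMeasurable_of_mem_LinftyPos h₀
  have m₁ := aestronglyMeasurable_of_mem_LinftyPos h₁
  have q₀ := (m₀.aemeasurable.pow_const (1 / (p - 1))).aestronglyMeasurable
  have q₁ := (m₁.aemeasurable.pow_const (1 / (p - 1))).aestronglyMeasurable
  have hint : Integrable (fun x => σ₀ x / σ₁ x ^ (1 / (p - 1))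
      * (σ₁ x ^ (1 / (p - 1)) - σ₀ x ^ (1 / (p - 1))) * ‖weakGrad u x‖ ^ p)
      (volume.restrict Ω) := by
    refine integrable_mul_norm_rpow (M := M₀ / ε₁ ^ (1 / (p - 1)) *
      (M₁ ^ (1 / (p - 1)) + M₀ ^ (1 / (p - 1)))) ((m₀.div₀ q₁).mul (q₁.sub q₀)) ?_
      (memLp_weakGrad u)
    filter_upwards [hb₀, hb₁] with x hx₀ hx₁
    have hs₀ : 0 < σ₀ x := by linarith
    have hs₁ : 0 < σ₁ x := by linarith
    simp only [Pi.mul_apply, Pi.div_apply, Pi.sub_apply]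
    rw [norm_mul, Real.norm_of_nonneg (by positivity)]
    gcongr
    · exact hx₀.2
    · exact hx₁.1.le
    · refine (norm_sub_le _ _).trans ?_
      rw [Real.norm_of_nonneg (by positivity), Real.norm_of_nonneg (by positivity)]
      gcongr
      · exact hx₁.2
      · exact hx₀.2
  have i1 := integrable_energy_density h₁ (memLp_weakGrad v)
  have i2 := (integrable_fluxPairing h₀ u v).const_mul p
  have i12 : Integrable (fun x => σ₁ x * ‖weakGrad v x‖ ^ p
      - p * inner ℝ (flux σ₀ u x) (weakGrad v x)) (volume.restrict Ω) := i1.sub i2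
  have i3 := (integrable_energy_density h₀ (memLp_weakGrad u)).const_mul (p - 1)
  rw [energy, energy, fluxPairing, ← integral_const_mul, ← integral_const_mul,
    ← integral_const_mul, ← integral_sub i1 i2, ← integral_add i12 i3]
  refine integral_mono_ae (hint.const_mul _) (i12.add i3) ?_
  filter_upwards [hb₀, hb₁] with x hx₀ hx₁
  have hs₀ : 0 < σ₀ x := by linarith
  have hs₁ : 0 < σ₁ x := by linarith
  have hy := weighted_young hp1 hs₀ hs₁ (weakGrad v x) (weakGrad u x)
  have hq : σ₀ x / σ₁ x ^ (1 / (p - 1)) * (σ₁ x ^ (1 / (p - 1)) - σ₀ x ^ (1 / (p - 1)))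
      = σ₀ x - σ₀ x * (σ₀ x ^ (1 / (p - 1)) / σ₁ x ^ (1 / (p - 1))) := by
    have : σ₁ x ^ (1 / (p - 1)) ≠ 0 := by positivity
    field_simp
  simp only [hq, inner_flux]
  linarith

end dirichlet

end PCalderon

end

/-- Monotonicity inequality for the nonlinear Dirichlet-to-Neumann map. The first two parts say that
the Dirichlet problem is uniquely solvable and that the map `Λ_σ` is given by its weak formula,
the third part is the two-sided inequality. -/
theorem lemma2p1 {n : ℕ} (hn : 2 ≤ n) {Ω : Set (PCalderon.E n)} (hΩ : IsOpen Ω)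
    (hΩb : Bornology.IsBounded Ω) {p : ℝ} [hp : Fact (1 < p)] :
    (∀ σ ∈ PCalderon.LinftyPos Ω, ∀ F : PCalderon.TraceSpace Ω p,
      ∃! u : PCalderon.W1p Ω p, PCalderon.SolvesDirichlet σ F u) ∧
    (∀ σ ∈ PCalderon.LinftyPos Ω, ∀ (F : PCalderon.TraceSpace Ω p) (u v : PCalderon.W1p Ω p),
      PCalderon.SolvesDirichlet σ F u →
        PCalderon.dnMap σ F (PCalderon.trace v)
          = ∫ x in Ω, inner ℝ (PCalderon.flux σ u x) (PCalderon.weakGrad v x)) ∧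
    (∀ σ₀ ∈ PCalderon.LinftyPos Ω, ∀ σ₁ ∈ PCalderon.LinftyPos Ω, ∀ f u₀ : PCalderon.W1p Ω p,
      PCalderon.SolvesDirichlet σ₀ (PCalderon.trace f) u₀ →
        (p - 1) * (∫ x in Ω, σ₀ x / σ₁ x ^ (1 / (p - 1))
              * (σ₁ x ^ (1 / (p - 1)) - σ₀ x ^ (1 / (p - 1))) * ‖PCalderon.weakGrad u₀ x‖ ^ p)
            ≤ (PCalderon.dnMap σ₁ (PCalderon.trace f) - PCalderon.dnMap σ₀ (PCalderon.trace f))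
                (PCalderon.trace f) ∧
        (PCalderon.dnMap σ₁ (PCalderon.trace f) - PCalderon.dnMap σ₀ (PCalderon.trace f))
                (PCalderon.trace f)
            ≤ ∫ x in Ω, (σ₁ x - σ₀ x) * ‖PCalderon.weakGrad u₀ x‖ ^ p) := by
  refine ⟨fun σ hσ F => PCalderon.existsUnique_solvesDirichlet hn hΩb hσ F,
    fun σ hσ F u v hu => PCalderon.dnMap_trace hn hΩb hσ hu v, fun σ₀ h₀ σ₁ h₁ f u₀ hu₀ => ?_⟩
  obtain ⟨u₁, hu₁, -⟩ := PCalderon.existsUnique_solvesDirichlet hn hΩb h₁ (PCalderon.trace f)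
  rw [sub_apply, PCalderon.dnMap_trace_self hn hΩb h₀ hu₀,
    PCalderon.dnMap_trace_self hn hΩb h₁ hu₁]
  constructor
  · have h1 := PCalderon.mul_fluxPairing_le h₀ h₁ u₀ u₁
    have h2 := hu₀.1.fluxPairing_eq_zero h₀
      (PCalderon.trace_eq_iff.1 (hu₁.2.trans hu₀.2.symm))
    rw [PCalderon.fluxPairing_sub h₀, PCalderon.fluxPairing_self] at h2
    -- With this the right side of h1 collapses to the difference of the two energies.
    have h3 : PCalderon.fluxPairing σ₀ u₀ u₁ = PCalderon.energy σ₀ u₀ := by linarith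
    rw [h3] at h1
    linarith
  · have h1 := hu₁.energy_le h₁ (PCalderon.trace_eq_iff.1 hu₀.2)
    simp_rw [sub_mul]
    rw [integral_sub
      (PCalderon.integrable_energy_density h₁ (PCalderon.memLp_weakGrad u₀))
      (PCalderon.integrable_energy_density h₀ (PCalderon.memLp_weakGrad u₀))]
    exact sub_le_sub_right h1 _
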